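/- \textbf{Theorem (Expected Rank Growth).} Let $0\le d'<d$ be integers. Let $X=\prod_i[a_i,a_i+l]$ and $Y=\prod_i[b_i,b_i+l]$ be compact hypercubes in $\mathbb R^d$ of the same side length $l>0$ that share a $d'$-dimensional hypersurface: in each coordinate the intervals $[a_i,a_i+l]$ and $[b_i,b_i+l]$ are equal or adjacent, and they are equal in exactly $d'$ coordinates. Let $\mathcal K$ be a real- or complex-valued measurable kernel, of which only the values on $\operatorname{int}X\times\operatorname{int}Y$ matter, that is \emph{analytic in the far field}: there are constants $\rho>1$ and $M$ such that, for every cube $Q=\prod_i[c_i,c_i+s]\subseteq Y$ with $s>0$ whose maximum-norm distance to $X$ is at least its side length $s$, and for every $x\in\operatorname{int}X$, the function $\mathcal K(x,\cdot)$ on $Q\cap\operatorname{int}Y$ extends to a holomorphic function $F$ on the generalized Bernstein ellipse $$\mathcal B(Q,\rho)=\Big\{z\in\mathbb C^d:\ |z_i-c_i|+|z_i-c_i-s|<\tfrac s2(\rho+\rho^{-1})\ \text{ for all } i\Big\}$$ with $|F|\le M\sup_{Q\cap \operatorname{int}Y}|\mathcal K(x,\cdot)|$ on $\mathcal B(Q,\rho)$.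 For $n\ge2$ let $x_1,\dots,x_n,y_1,\dots,y_n$ be independent random points, the $x_i$ uniformly distributed on $X$ and the $y_j$ on $Y$, and let $K=(\mathcal K(x_i,y_j))_{i,j}$ be the random kernel matrix. Write $\|A\|_{\infty^*}=\max_{i,j}|A_{ij}|$. Then there is a constant $C>0$ that depends only on $d$ and $d'$ (and not on $X$, $Y$, $\mathcal K$, $\delta$ or $n$) such that for every tolerance $\delta>0$ there is a constant $p\in\mathbb N$, depending only on $\delta$ and the kernel (with its domain), with the following property. For every $n\ge2$ there is a random matrix $\tilde K$ (real if $\mathcal K$ is real-valued) such that almost surely $\|K-\tilde K\|_{\infty^*}/\|K\|_{\infty^*}<\delta$ if $K\ne0$, and $\tilde K=0$ if $K=0$, and whose random rank $\mathcal R=\operatorname{rank}\tilde K$ satisfies \begin{enumerate} \item[(i)] if $d'=0$ (vertex sharing), $\mathbb E[\mathcal R]\le C\,p\,\log_{2^d}n$; \item[(ii)] if $d'\ne0$, $\mathbb E[\mathcal R]\le C\,p\,n^{d'/d}$. \end{enumerate} -/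

import Mathlib

open MeasureTheory ProbabilityTheory

noncomputable section

/-- The compact axis-parallel hypercube with lowest corner `a` and side length `s`. -/
def hypercube {d : ℕ} (a : Fin d → ℝ) (s : ℝ) : Set (Fin d → ℝ) :=
  {x | ∀ i, a i ≤ x i ∧ x i ≤ a i + s}

/-- Two hypercubes with lowest corners `a`, `b` and the same side length `l` share a
`d'`-dimensional hypersurface: in every coordinate their edges coincide or are adjacent, and they
coincide in exactly `d'` coordinates. So `X ∩ Y` is a common `d'`-dimensional face (a vertex if
`d' = 0`); up to a translation and reflections and permutations of the coordinates this is
`Y = [0,l]^d`, `X = [0,l]^d' × [-l,0]^(d-d')`. -/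
def ShareHypersurface {d : ℕ} (a b : Fin d → ℝ) (l : ℝ) (d' : ℕ) : Prop :=
  (∀ i, a i = b i ∨ a i + l = b i ∨ b i + l = a i) ∧
    (Finset.univ.filter fun i => a i = b i).card = d'

/-- The hypercube with lowest corner `c` and side `s` is at least one hypercube away from the set
`X`. The distance on `Fin d → ℝ` is that of the maximum norm. -/
def FarFrom {d : ℕ} (X : Set (Fin d → ℝ)) (c : Fin d → ℝ) (s : ℝ) : Prop :=
  ∀ x ∈ X, ∀ y ∈ hypercube c s, s ≤ dist x y

/-- The (open) generalized Bernstein ellipse with parameter `ρ` of the hypercube with lowest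
corner `c` and side `s`: the product over the coordinates of the open elliptic discs in `ℂ` with
foci `c i` and `c i + s`, the affine images of the Bernstein ellipse of `[-1,1]`, whose semi-axes
add up to `ρ`. -/
def bernsteinEllipse {d : ℕ} (c : Fin d → ℝ) (s ρ : ℝ) : Set (Fin d → ℂ) :=
  {z | ∀ i, ‖z i - (c i : ℂ)‖ + ‖z i - ((c i + s : ℝ) : ℂ)‖ < s * (ρ + ρ⁻¹) / 2}

/-- The kernel `k`, which matters on `int X × int Y` only, is analytic in the far field, with
constants `ρ` and `M` that depend on the kernel only: on each subcube `Q ⊆ Y` that is at least one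
hypercube away from `X`, and for each target point `x`, the function `k x` has an analytic
extension `F` to the generalized Bernstein ellipse of `Q` with parameter `ρ`, and `|F|` is at most
`M` times the supremum of `|k x|` on `Q` there (that is, at most `M * B` for each upper bound `B`
of `|k x|` on `Q`). -/
def FarFieldAnalytic {𝕜 : Type*} [RCLike 𝕜] {d : ℕ} (X Y : Set (Fin d → ℝ))
    (k : (Fin d → ℝ) → (Fin d → ℝ) → 𝕜) : Prop :=
  ∃ ρ M : ℝ, 1 < ρ ∧
    ∀ (c : Fin d → ℝ) (s : ℝ), 0 < s → hypercube c s ⊆ Y → FarFrom X c s →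
      ∀ x ∈ interior X, ∃ F : (Fin d → ℂ) → ℂ,
        DifferentiableOn ℂ F (bernsteinEllipse c s ρ) ∧
        (∀ y ∈ hypercube c s ∩ interior Y, F (fun i => (y i : ℂ)) =
          (RCLike.re (k x y) : ℂ) + (RCLike.im (k x y) : ℂ) * Complex.I) ∧
        ∀ B : ℝ, (∀ y ∈ hypercube c s ∩ interior Y, ‖k x y‖ ≤ B) →
          ∀ z ∈ bernsteinEllipse c s ρ, ‖F z‖ ≤ M * B

/-- The kernel matrix `K i j = k (x i) (y j)` of targets `x` and sources `y`. -/
def kernelMatrix {𝕜 : Type*} {d n : ℕ} (k : (Fin d → ℝ) → (Fin d → ℝ) → 𝕜)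
    (x y : Fin n → Fin d → ℝ) : Matrix (Fin n) (Fin n) 𝕜 :=
  Matrix.of fun i j => k (x i) (y j)

/-- The max-norm `max |A i j|` of a matrix. -/
def maxNorm {𝕜 : Type*} [RCLike 𝕜] {n : ℕ} (A : Matrix (Fin n) (Fin n) 𝕜) : ℝ :=
  ⨆ ij : Fin n × Fin n, ‖A ij.1 ij.2‖

/-- The relative max-norm error of the approximation `A'` of `A` is smaller than `δ`. The zero
matrix, for which the quotient is `0 / 0`, is approximated by itself only. -/
def RelErrorLT {𝕜 : Type*} [RCLike 𝕜] {n : ℕ} (A A' : Matrix (Fin n) (Fin n) 𝕜) (δ : ℝ) : Prop :=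
  (A = 0 → A' = 0) ∧ (A ≠ 0 → maxNorm (A - A') / maxNorm A < δ)

/-- `x` and `y` are the random particles: all `2n` of them are independent, the targets `x i` are
uniformly distributed on `X` and the sources `y j` on `Y` (so almost surely in the interiors). -/
structure UniformParticles {Ω : Type*} [MeasurableSpace Ω] (P : Measure Ω) {d n : ℕ}
    (X Y : Set (Fin d → ℝ)) (x y : Fin n → Ω → Fin d → ℝ) : Prop where
  measurable_target : ∀ i, Measurable (x i)
  measurable_source : ∀ j, Measurable (y j)
  indep : iIndepFun (Sum.elim x y) P
  uniform_target : ∀ i, pdf.IsUniform (x i) X P volume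
  uniform_source : ∀ j, pdf.IsUniform (y j) Y P volume

end

/-! The approximation repeats columns of `K`, so its rank is at most the number of distinct columns
kept. Subdivide `Y` dyadically towards the shared face down to level `κ = Nat.log (2 ^ d) n`, where
a cell holds about one point. The far cells, those not touching `X` although their parents do, are
at least one side length away from `X`. Cut each far cell into `N = R ^ d` subcells. If all of them
contain a source, each column of the cell is replaced by a fixed column from its subcell; all other
columns stay.

Accuracy is measured against the sampled entries, not against the supremum of the kernel. By the
Schwarz lemma the kernel oscillates by at most a small multiple of its supremum `B` over a subcell.
A sample meeting every subcell with values at most `A` therefore gives `B ≤ A + q * B`, hence `B ≤ 2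
* A` (`FarFieldAnalytic.exists_mesh`).

The expected number of columns has three parts: at most `N` representatives per far cell; the points
in far cells with an empty subcell; and the points outside the far cells. An empty subcell of
probability at least `v` in a cell of probability at most `N * v` accounts for at most `N * (n * v *
(1 - v) ^ (n - 1)) ≤ N` expected points, so a far cell costs `N + N ^ 2`, independently of `n`
(`lintegral_card_image_cellRepresentative_le`). Level `ℓ` has at most `2 ^ (ℓ * d') * 2 ^ d` far
cells, and about `n * 2 ^ (-κ * (d - d'))` points remain near `X`. Summing over the levels gives the
logarithm for `d' = 0` and a geometric sum otherwise. -/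

/-! ### Bernstein ellipses and the oscillation of the kernel on far cubes -/

theorem RCLike.norm_re_add_im_mul_I {𝕜 : Type*} [RCLike 𝕜] (z : 𝕜) :
    ‖(RCLike.re z : ℂ) + (RCLike.im z : ℂ) * Complex.I‖ = ‖z‖ := by
  rw [← sq_eq_sq₀ (norm_nonneg _) (norm_nonneg _), ← Complex.normSq_eq_norm_sq,
    Complex.normSq_add_mul_I, RCLike.norm_sq_eq_def]
  ring

theorem hypercube_eq_Icc {d : ℕ} (c : Fin d → ℝ) (s : ℝ) :
    hypercube c s = Set.Icc c (fun i => c i + s) := by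
  ext y
  exact ⟨fun h => ⟨fun i => (h i).1, fun i => (h i).2⟩, fun h i => ⟨h.1 i, h.2 i⟩⟩

theorem isCompact_hypercube {d : ℕ} (c : Fin d → ℝ) (s : ℝ) : IsCompact (hypercube c s) := by
  rw [hypercube_eq_Icc]
  exact isCompact_Icc

/-- On the segment between the foci the two focal distances add up to `s`. Moving by `t` raises the
sum by at most `2 * t`, and the radius is half of the slack `s * (ρ + ρ⁻¹) / 2 - s`. -/
theorem ball_subset_bernsteinEllipse {d : ℕ} {c : Fin d → ℝ} {s : ℝ} (ρ : ℝ) {y : Fin d → ℝ}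
    (hy : y ∈ hypercube c s) :
    Metric.ball (fun i => (y i : ℂ)) (s * ((ρ + ρ⁻¹ - 2) / 4)) ⊆ bernsteinEllipse c s ρ := by
  intro z hz i
  rw [mem_ball_iff_norm] at hz
  have h1 : ‖z i - y i‖ < s * ((ρ + ρ⁻¹ - 2) / 4) := (norm_le_pi_norm _ i).trans_lt hz
  have h2 : ‖z i - (c i : ℂ)‖ ≤ ‖z i - y i‖ + (y i - c i) := by
    have : ‖((y i - c i : ℝ) : ℂ)‖ = y i - c i := by
      rw [Complex.norm_real, Real.norm_of_nonneg (sub_nonneg.2 (hy i).1)]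
    rw [← this]
    refine le_trans (le_of_eq ?_) (norm_add_le _ _)
    congr 1
    push_cast
    ring
  have h3 : ‖z i - ((c i + s : ℝ) : ℂ)‖ ≤ ‖z i - y i‖ + (c i + s - y i) := by
    have : ‖((y i - (c i + s) : ℝ) : ℂ)‖ = c i + s - y i := by
      rw [Complex.norm_real, Real.norm_of_nonpos (sub_nonpos.2 (hy i).2)]
      ring
    rw [← this]
    refine le_trans (le_of_eq ?_) (norm_add_le _ _)
    congr 1
    push_cast
    ring
  linarith

/-- A holomorphic function bounded on the Bernstein ellipse of a cube is Lipschitz on the cube. -/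
theorem norm_sub_le_of_bernsteinEllipse {d : ℕ} {c : Fin d → ℝ} {s ρ B : ℝ} (hs : 0 < s)
    (hρ : 1 < ρ) {F : (Fin d → ℂ) → ℂ} (hF : DifferentiableOn ℂ F (bernsteinEllipse c s ρ))
    (hB : ∀ z ∈ bernsteinEllipse c s ρ, ‖F z‖ ≤ B) {y y' : Fin d → ℝ}
    (hy : y ∈ hypercube c s) (hy' : y' ∈ hypercube c s) :
    ‖F (fun i => (y i : ℂ)) - F (fun i => (y' i : ℂ))‖ ≤
      2 * B / (s * ((ρ + ρ⁻¹ - 2) / 4)) * dist y y' := by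
  have hτ : 0 < (ρ + ρ⁻¹ - 2) / 4 := by
    have : ρ + ρ⁻¹ - 2 = (ρ - 1) ^ 2 / ρ := by field_simp; ring
    rw [this]
    have : 0 < ρ - 1 := by linarith
    positivity
  set r := s * ((ρ + ρ⁻¹ - 2) / 4) with hr
  have hr0 : 0 < r := by positivity
  have hb := ball_subset_bernsteinEllipse ρ hy'
  rw [← hr] at hb
  have hball : ∀ {u : Fin d → ℝ}, u ∈ hypercube c s → (fun i => (u i : ℂ)) ∈ bernsteinEllipse c s ρ :=
    fun hu => ball_subset_bernsteinEllipse ρ hu (Metric.mem_ball_self hr0)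
  have hmap : ∀ z ∈ bernsteinEllipse c s ρ, ‖F z - F (fun i => (y' i : ℂ))‖ ≤ 2 * B := fun z hz => by
    have := norm_sub_le (F z) (F (fun i => (y' i : ℂ)))
    linarith [hB z hz, hB _ (hball hy')]
  have hB0 : 0 ≤ B := (norm_nonneg _).trans (hB _ (hball hy'))
  have hd : dist (fun i => (y i : ℂ)) (fun i => (y' i : ℂ)) = dist y y' := by
    simp only [dist_pi_def, nndist_eq_nnnorm, ← Complex.ofReal_sub, Complex.nnnorm_real]
  rcases lt_or_ge (dist y y') r with h | h
  · rw [← dist_eq_norm, ← hd]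
    -- Schwarz lemma on the ball of radius `r` about `y'`, which `F` maps into the closed ball of
    -- radius `2 * B` about its value at `y'`.
    refine Complex.dist_le_div_mul_dist_of_mapsTo_ball (hF.mono hb) (fun z hz => ?_) ?_
    · rw [mem_closedBall_iff_norm]
      exact hmap z (hb hz)
    · rwa [Metric.mem_ball, hd]
  -- At distance at least `r` the trivial bound `2 * B` suffices.
  · refine (hmap _ (hball hy)).trans ?_
    rw [div_mul_eq_mul_div, le_div_iff₀ hr0]
    gcongr

/-- A far-field analytic kernel oscillates little, relative to its values on any sufficiently dense
sample, on the cells of a fine enough subdivision of a far cube. -/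
theorem FarFieldAnalytic.exists_mesh {𝕜 : Type*} [RCLike 𝕜] {d : ℕ} {X Y : Set (Fin d → ℝ)}
    {k : (Fin d → ℝ) → (Fin d → ℝ) → 𝕜} (h : FarFieldAnalytic X Y k) {ε : ℝ} (hε : 0 < ε) :
    ∃ R : ℕ, 0 < R ∧ ∀ (c : Fin d → ℝ) (s : ℝ), 0 < s → hypercube c s ⊆ Y → FarFrom X c s →
      ∀ x ∈ interior X, ∀ T ⊆ hypercube c s ∩ interior Y,
      (∀ y ∈ hypercube c s, ∃ t ∈ T, dist y t ≤ s / R) →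
      ∀ A : ℝ, (∀ t ∈ T, ‖k x t‖ ≤ A) →
      ∀ y ∈ hypercube c s ∩ interior Y, ∀ y' ∈ hypercube c s ∩ interior Y, dist y y' ≤ s / R →
        ‖k x y - k x y'‖ ≤ ε * A := by
  obtain ⟨ρ, M, hρ, h⟩ := h
  have hτ : 0 < (ρ + ρ⁻¹ - 2) / 4 := by
    have : ρ + ρ⁻¹ - 2 = (ρ - 1) ^ 2 / ρ := by field_simp; ring
    rw [this]
    have : 0 < ρ - 1 := by linarith
    positivity
  set τ := (ρ + ρ⁻¹ - 2) / 4 with hτ_def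
  -- The bound `1 / 2` turns `B ≤ A + q * B` into `B ≤ 2 * A`; the bound `ε / 2` then gives `q * B ≤
  -- ε * A`.
  set q := min (1 / 2) (ε / 2) with hq
  have hq0 : 0 < q := by positivity
  obtain ⟨R, hR⟩ := exists_nat_gt (2 * |M| / τ / q)
  have hR0 : (0 : ℝ) < R := lt_of_le_of_lt (by positivity) hR
  refine ⟨R, by exact_mod_cast hR0, ?_⟩
  intro c s hs hQY hfar x hx T hT hdense A hA y hy y' hy' hyy'
  obtain ⟨F, hF, hFk, hFB⟩ := h c s hs hQY hfar x hx
  have hnorm : ∀ u ∈ hypercube c s ∩ interior Y, ‖F (fun i => (u i : ℂ))‖ = ‖k x u‖ :=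
    fun u hu => by rw [hFk u hu, RCLike.norm_re_add_im_mul_I]
  have hsub : ∀ u ∈ hypercube c s ∩ interior Y, ∀ v ∈ hypercube c s ∩ interior Y,
      ‖F (fun i => (u i : ℂ)) - F (fun i => (v i : ℂ))‖ = ‖k x u - k x v‖ := fun u hu v hv => by
    rw [hFk u hu, hFk v hv, ← RCLike.norm_re_add_im_mul_I (k x u - k x v)]
    congr 1
    simp only [map_sub]
    push_cast
    ring
  -- The bound by `M` presupposes a finite supremum; it is finite because the extension is
  -- continuous on the compact cube.
  have hbdd : BddAbove ((fun u => ‖k x u‖) '' (hypercube c s ∩ interior Y)) := by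
    have hcont : ContinuousOn (fun u : Fin d → ℝ => ‖F (fun i => (u i : ℂ))‖) (hypercube c s) := by
      refine (hF.continuousOn.comp (by fun_prop) fun u hu => ?_).norm
      exact ball_subset_bernsteinEllipse ρ hu (Metric.mem_ball_self (by positivity))
    obtain ⟨B, hB⟩ := (isCompact_hypercube c s).bddAbove_image hcont
    refine ⟨B, ?_⟩
    rintro _ ⟨u, hu, rfl⟩
    simp only
    rw [← hnorm u hu]
    exact hB ⟨u, hu.1, rfl⟩
  set B := sSup ((fun u => ‖k x u‖) '' (hypercube c s ∩ interior Y)) with hB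
  have hkB : ∀ u ∈ hypercube c s ∩ interior Y, ‖k x u‖ ≤ B := fun u hu =>
    le_csSup hbdd ⟨u, hu, rfl⟩
  have hB0 : 0 ≤ B := (norm_nonneg _).trans (hkB y hy)
  have hosc : ∀ u ∈ hypercube c s ∩ interior Y, ∀ v ∈ hypercube c s ∩ interior Y,
      dist u v ≤ s / R → ‖k x u - k x v‖ ≤ q * B := by
    intro u hu v hv huv
    rw [← hsub u hu v hv]
    have hle : ∀ z ∈ bernsteinEllipse c s ρ, ‖F z‖ ≤ |M| * B := fun z hz =>
      (hFB B hkB z hz).trans (mul_le_mul_of_nonneg_right (le_abs_self M) hB0)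
    refine (norm_sub_le_of_bernsteinEllipse hs hρ hF hle hu.1 hv.1).trans ?_
    rw [← hτ_def]
    calc 2 * (|M| * B) / (s * τ) * dist u v ≤ 2 * (|M| * B) / (s * τ) * (s / R) := by gcongr
      _ = 2 * |M| / τ / R * B := by field_simp
      _ ≤ q * B := by
        gcongr
        rw [div_lt_iff₀ hq0] at hR
        rw [div_le_iff₀ hR0]
        linarith
  -- Each point of the cube has a sample point within mesh distance, so the sample controls the
  -- supremum.
  have hBA : B ≤ A + q * B := by
    refine csSup_le ⟨_, y, hy, rfl⟩ ?_
    rintro _ ⟨u, hu, rfl⟩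
    obtain ⟨t, ht, hut⟩ := hdense u hu.1
    have h1 := hosc u hu t (hT ht) hut
    have h2 := norm_le_norm_add_norm_sub' (k x u) (k x t)
    have h3 := hA t ht
    simp only
    linarith
  have hq1 : q ≤ 1 / 2 := min_le_left _ _
  have hq2 : q ≤ ε / 2 := min_le_right _ _
  have hB2 : B ≤ 2 * A := by nlinarith
  refine (hosc y hy y' hy' hyy').trans ?_
  calc q * B ≤ ε / 2 * (2 * A) := by gcongr
    _ = ε * A := by ring

/-! ### Representatives of cells and their expected number -/

open Classical in
/-- The index whose value stands in for the value at `j`: if the cell of `j` belongs to `G` and all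
its subcells are occupied, it is a fixed index in the subcell of `j`, and otherwise it is `j`. -/
noncomputable def cellRepresentative {ι α β : Type*} [Nonempty ι] (G : Finset α)
    (lam : ι → α × β) (j : ι) : ι :=
  if (lam j).1 ∈ G ∧ ∀ r, ∃ j', lam j' = ((lam j).1, r) then Function.invFun lam (lam j) else j

theorem cellRepresentative_spec {ι α β : Type*} [Nonempty ι] (G : Finset α)
    (lam : ι → α × β) (j : ι) :
    cellRepresentative G lam j = j ∨
      (lam j).1 ∈ G ∧ (∀ r, ∃ j', lam j' = ((lam j).1, r)) ∧
        lam (cellRepresentative G lam j) = lam j := by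
  unfold cellRepresentative
  split_ifs with h
  · exact Or.inr ⟨h.1, h.2, Function.invFun_eq ⟨j, rfl⟩⟩
  · exact Or.inl rfl

-- An index in the image comes from a point outside `G`, or is the fixed index of a subcell, or is a
-- point whose cell has an empty subcell. The last kind is summed over all possible empty subcells,
-- so it may be counted repeatedly.
open Classical in
theorem card_image_cellRepresentative_le {ι α β : Type*} [Nonempty ι] [Fintype ι] [Fintype β]
    (G : Finset α) (lam : ι → α × β) :
    (Finset.univ.image (cellRepresentative G lam)).card ≤
      (Finset.univ.filter fun j => (lam j).1 ∉ G).card + G.card * Fintype.card β +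
        ∑ u ∈ G ×ˢ (Finset.univ : Finset β),
          (Finset.univ.filter fun j => (lam j).1 = u.1 ∧ ∀ j', lam j' ≠ u).card := by
  have hsub : Finset.univ.image (cellRepresentative G lam) ⊆
      (Finset.univ.filter fun j => (lam j).1 ∉ G) ∪
        (G ×ˢ (Finset.univ : Finset β)).image (Function.invFun lam) ∪
        (G ×ˢ (Finset.univ : Finset β)).biUnion
          fun u => Finset.univ.filter fun j => (lam j).1 = u.1 ∧ ∀ j', lam j' ≠ u := by
    intro i hi
    obtain ⟨j, -, rfl⟩ := Finset.mem_image.1 hi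
    by_cases hG : (lam j).1 ∈ G
    · by_cases hocc : ∀ r, ∃ j', lam j' = ((lam j).1, r)
      · refine Finset.mem_union_left _ (Finset.mem_union_right _ (Finset.mem_image.2
          ⟨lam j, by simp [hG], ?_⟩))
        rw [cellRepresentative, if_pos ⟨hG, hocc⟩]
      · rw [cellRepresentative, if_neg fun h => hocc h.2]
        push Not at hocc
        obtain ⟨r, hr⟩ := hocc
        refine Finset.mem_union_right _ (Finset.mem_biUnion.2 ⟨((lam j).1, r), by simp [hG], ?_⟩)
        simpa using hr
    · rw [cellRepresentative, if_neg fun h => hG h.1]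
      exact Finset.mem_union_left _ (Finset.mem_union_left _ (by simp [hG]))
  refine (Finset.card_le_card hsub).trans ((Finset.card_union_le _ _).trans ?_)
  refine add_le_add ((Finset.card_union_le _ _).trans ?_) Finset.card_biUnion_le
  refine add_le_add le_rfl (Finset.card_image_le.trans ?_)
  rw [Finset.card_product, Finset.card_univ]

/-- The left side is the probability of exactly one success in `n` trials: one term of the binomial
expansion of `(t + (1 - t)) ^ n = 1`. -/
theorem mul_mul_one_sub_pow_le_one {t : ℝ} (h0 : 0 ≤ t) (h1 : t ≤ 1) (n : ℕ) :
    n * (t * (1 - t) ^ (n - 1)) ≤ 1 := by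
  rcases Nat.eq_zero_or_pos n with rfl | hn
  · simp
  have h1' : 0 ≤ 1 - t := sub_nonneg.2 h1
  have h := add_pow t (1 - t) n
  rw [add_sub_cancel, one_pow] at h
  refine le_trans ?_ h.ge
  refine le_trans (le_of_eq ?_) (Finset.single_le_sum (fun m _ => ?_)
    (Finset.mem_range.2 (show 1 < n + 1 by omega)))
  · simp
    ring
  · positivity

theorem lintegral_card_filter {Ω ι : Type*} [MeasurableSpace Ω] (P : Measure Ω) [Fintype ι]
    (p : ι → Ω → Prop) [∀ ω, DecidablePred fun j => p j ω] (hp : ∀ j, MeasurableSet {ω | p j ω}) :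
    ∫⁻ ω, ((Finset.univ.filter fun j => p j ω).card : ENNReal) ∂P = ∑ j, P {ω | p j ω} := by
  classical
  have h : ∀ ω, ((Finset.univ.filter fun j => p j ω).card : ENNReal) =
      ∑ j, Set.indicator {ω | p j ω} 1 ω := fun ω => by
    simp [Set.indicator_apply]
  simp_rw [h]
  rw [lintegral_finsetSum _ fun j _ => measurable_one.indicator (hp j)]
  simp [hp]

/-- By independence, the point `j` lies in the cell while the others avoid the subcell with
probability at most `N * v * (1 - v) ^ (n - 1)`, where `n` is the number of points. The sum over `j`
is bounded by `mul_mul_one_sub_pow_le_one`. -/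
theorem sum_measure_cell_unoccupied_le {Ω ι α β : Type*} [MeasurableSpace Ω] (P : Measure Ω)
    [IsProbabilityMeasure P] [Fintype ι] [MeasurableSpace α]
    [MeasurableSpace β] [DiscreteMeasurableSpace (α × β)] {L : ι → Ω → α × β}
    (hind : iIndepFun L P) (hL : ∀ j, Measurable (L j)) {q : α} {r : β} {v N : ℝ} (hv0 : 0 ≤ v)
    (hN : 0 ≤ N)
    (hocc : ∀ j, v ≤ P.real {ω | L j ω = (q, r)}) (hcell : ∀ j, P.real {ω | (L j ω).1 = q} ≤ N * v) :
    ∑ j, P {ω | (L j ω).1 = q ∧ ∀ j', L j' ω ≠ (q, r)} ≤ ENNReal.ofReal N := by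
  classical
  rcases isEmpty_or_nonempty ι with hι | ⟨⟨j₀⟩⟩
  · simp
  have hv1 : v ≤ 1 := (hocc j₀).trans measureReal_le_one
  have key : ∀ j, P.real {ω | (L j ω).1 = q ∧ ∀ j', L j' ω ≠ (q, r)} ≤
      N * v * (1 - v) ^ (Fintype.card ι - 1) := by
    intro j
    -- Dropping the condition that `j` itself avoids the subcell leaves one condition per point,
    -- hence a product.
    let S : ι → Set (α × β) := fun j' => if j' = j then {u | u.1 = q} else {u | u ≠ (q, r)}
    have hS : ∀ j', MeasurableSet (S j') := fun j' => MeasurableSet.of_discrete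
    have hmul := hind.measure_inter_preimage_eq_mul Finset.univ (sets := S) fun j' _ => hS j'
    have hle : P.real {ω | (L j ω).1 = q ∧ ∀ j', L j' ω ≠ (q, r)} ≤
        ∏ j', P.real (L j' ⁻¹' S j') := by
      simp only [Measure.real]
      rw [← ENNReal.toReal_prod, ← hmul]
      refine ENNReal.toReal_mono (measure_ne_top _ _) (measure_mono fun ω hω => ?_)
      simp only [Finset.mem_univ, Set.iInter_true, Set.mem_iInter, Set.mem_preimage]
      intro j'
      by_cases hj : j' = j
      · subst hj
        simpa [S] using hω.1
      · simpa [S, hj] using hω.2 j'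
    refine hle.trans ?_
    rw [← Finset.mul_prod_erase _ _ (Finset.mem_univ j)]
    refine mul_le_mul (by simpa [S] using hcell j) ?_ (Finset.prod_nonneg fun _ _ => by positivity)
      (by positivity)
    have hcard : (Finset.univ.erase j).card = Fintype.card ι - 1 := by
      rw [Finset.card_erase_of_mem (Finset.mem_univ j), Finset.card_univ]
    rw [← hcard, ← Finset.prod_const]
    refine Finset.prod_le_prod (fun _ _ => by positivity) fun j' hj' => ?_
    have hj : j' ≠ j := Finset.ne_of_mem_erase hj'
    have hc : L j' ⁻¹' S j' = (L j' ⁻¹' {(q, r)})ᶜ := by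
      ext ω
      simp [S, hj]
    rw [hc, measureReal_compl (hL j' MeasurableSet.of_discrete), probReal_univ]
    exact sub_le_sub_left (hocc j') 1
  have hsum : ∑ j, P {ω | (L j ω).1 = q ∧ ∀ j', L j' ω ≠ (q, r)} =
      ENNReal.ofReal (∑ j, P.real {ω | (L j ω).1 = q ∧ ∀ j', L j' ω ≠ (q, r)}) := by
    rw [ENNReal.ofReal_sum_of_nonneg fun _ _ => measureReal_nonneg]
    simp
  rw [hsum]
  refine ENNReal.ofReal_le_ofReal ((Finset.sum_le_sum fun j _ => key j).trans ?_)
  rw [Finset.sum_const, Finset.card_univ, nsmul_eq_mul]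
  calc (Fintype.card ι : ℝ) * (N * v * (1 - v) ^ (Fintype.card ι - 1))
      = N * (Fintype.card ι * (v * (1 - v) ^ (Fintype.card ι - 1))) := by ring
    _ ≤ N * 1 := by gcongr; exact mul_mul_one_sub_pow_le_one hv0 hv1 _
    _ = N := mul_one N

-- The square arises because each of the `Fintype.card β` subcells of a cell, when empty, accounts
-- for at most `Fintype.card β` expected points.
open Classical in
theorem lintegral_card_image_cellRepresentative_le {Ω ι α β : Type*} [MeasurableSpace Ω]
    (P : Measure Ω) [IsProbabilityMeasure P] [Nonempty ι] [Fintype ι] [Fintype β]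
    [MeasurableSpace α] [MeasurableSpace β] [DiscreteMeasurableSpace (α × β)]
    {L : ι → Ω → α × β} (hind : iIndepFun L P) (hL : ∀ j, Measurable (L j)) (G : Finset α)
    {v : α → ℝ} {w : ℝ} (hv0 : ∀ q, 0 ≤ v q) (hw : 0 ≤ w)
    (hocc : ∀ q ∈ G, ∀ r j, v q ≤ P.real {ω | L j ω = (q, r)})
    (hcell : ∀ q ∈ G, ∀ j, P.real {ω | (L j ω).1 = q} ≤ Fintype.card β * v q)
    (hnear : ∀ j, P.real {ω | (L j ω).1 ∉ G} ≤ w) :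
    ∫⁻ ω, ((Finset.univ.image (cellRepresentative G fun j => L j ω)).card : ENNReal) ∂P ≤
      ENNReal.ofReal (G.card * (Fintype.card β + (Fintype.card β : ℝ) ^ 2) +
        Fintype.card ι * w) := by
  set N := Fintype.card β
  have hm1 : ∀ j, MeasurableSet {ω | (L j ω).1 ∉ G} := fun j => by
    have : {ω | (L j ω).1 ∉ G} = L j ⁻¹' {u | u.1 ∉ G} := rfl
    rw [this]
    exact hL j MeasurableSet.of_discrete
  have hm2 : ∀ (u : α × β) (j : ι), MeasurableSet {ω | (L j ω).1 = u.1 ∧ ∀ j', L j' ω ≠ u} := by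
    intro u j
    have : {ω | (L j ω).1 = u.1 ∧ ∀ j', L j' ω ≠ u} =
        L j ⁻¹' {u' | u'.1 = u.1} ∩ ⋂ j', L j' ⁻¹' {u}ᶜ := by
      ext ω
      simp
    rw [this]
    exact (hL j MeasurableSet.of_discrete).inter
      (MeasurableSet.iInter fun j' => hL j' MeasurableSet.of_discrete)
  have hmc : ∀ u : α × β, Measurable fun ω =>
      ((Finset.univ.filter fun j => (L j ω).1 = u.1 ∧ ∀ j', L j' ω ≠ u).card : ENNReal) := by
    intro u
    simp only [Finset.card_filter, Nat.cast_sum, Nat.cast_ite, Nat.cast_one, Nat.cast_zero]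
    exact Finset.measurable_sum _ fun j _ =>
      Measurable.ite (hm2 u j) measurable_const measurable_const
  have hmn : Measurable fun ω =>
      ((Finset.univ.filter fun j => (L j ω).1 ∉ G).card : ENNReal) := by
    simp only [Finset.card_filter, Nat.cast_sum, Nat.cast_ite, Nat.cast_one, Nat.cast_zero]
    exact Finset.measurable_sum _ fun j _ =>
      Measurable.ite (hm1 j) measurable_const measurable_const
  calc ∫⁻ ω, ((Finset.univ.image (cellRepresentative G fun j => L j ω)).card : ENNReal) ∂P
      ≤ ∫⁻ ω, (((Finset.univ.filter fun j => (L j ω).1 ∉ G).card : ENNReal) + (G.card * N : ℕ) +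
        ∑ u ∈ G ×ˢ (Finset.univ : Finset β),
          ((Finset.univ.filter fun j => (L j ω).1 = u.1 ∧ ∀ j', L j' ω ≠ u).card : ENNReal)) ∂P :=
        lintegral_mono fun ω => 
          (Nat.cast_le.2 (card_image_cellRepresentative_le G fun j => L j ω)).trans_eq
            (by push_cast; rfl)
    _ = ∑ j, P {ω | (L j ω).1 ∉ G} + (G.card * N : ℕ) +
        ∑ u ∈ G ×ˢ (Finset.univ : Finset β),
          ∑ j, P {ω | (L j ω).1 = u.1 ∧ ∀ j', L j' ω ≠ u} := by
        rw [lintegral_add_left (hmn.add_const _), lintegral_add_left hmn,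
          lintegral_const, measure_univ, mul_one, lintegral_finsetSum _ fun u _ => hmc u,
          lintegral_card_filter P _ hm1]
        simp_rw [fun u : α × β => lintegral_card_filter P
          (fun j ω => (L j ω).1 = u.1 ∧ ∀ j', L j' ω ≠ u) (hm2 u)]
    _ ≤ ENNReal.ofReal (Fintype.card ι * w) + ENNReal.ofReal (G.card * N) +
        ENNReal.ofReal (G.card * N * N) := by
        refine add_le_add (add_le_add ?_ ?_) ?_
        · refine (Finset.sum_le_card_nsmul _ _ (ENNReal.ofReal w) fun j _ => ?_).trans ?_
          · rw [← ofReal_measureReal]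
            exact ENNReal.ofReal_le_ofReal (hnear j)
          · rw [Finset.card_univ, nsmul_eq_mul, ENNReal.ofReal_mul (by positivity),
              ENNReal.ofReal_natCast]
        · rw [← Nat.cast_mul, ENNReal.ofReal_natCast]
        · refine (Finset.sum_le_card_nsmul _ _ (ENNReal.ofReal N) fun u hu => ?_).trans ?_
          · have hu1 := (Finset.mem_product.1 hu).1
            exact sum_measure_cell_unoccupied_le P hind hL (hv0 u.1) (by positivity)
              (hocc u.1 hu1 u.2) (hcell u.1 hu1)
          · rw [Finset.card_product, Finset.card_univ, nsmul_eq_mul,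
              ENNReal.ofReal_mul (by positivity), ENNReal.ofReal_mul (by positivity)]
            simp only [ENNReal.ofReal_natCast]
            push_cast
            rfl
    _ = _ := by
        rw [← ENNReal.ofReal_add (by positivity) (by positivity),
          ← ENNReal.ofReal_add (by positivity) (by positivity)]
        congr 1
        ring

/-! ### Dyadic cells, their subcells and their geometry -/

/-- The index of the cube of level `ℓ` of the dyadic grid on `b + [0,l)^d` that contains `y`. -/
noncomputable def dyadicIndex {d : ℕ} (b : Fin d → ℝ) (l : ℝ) (ℓ : ℕ) (y : Fin d → ℝ) :
    Fin d → ℤ :=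
  fun i => ⌊(y i - b i) / (l / 2 ^ ℓ)⌋

/-- The lowest corner of a dyadic cube. -/
noncomputable def dyadicCorner {d : ℕ} (b : Fin d → ℝ) (l : ℝ) (q : ℕ × (Fin d → ℤ)) :
    Fin d → ℝ :=
  fun i => b i + l / 2 ^ q.1 * q.2 i

/-- The lowest corner of a subcell of the cube with lowest corner `c` and side `s`, subdivided into
`R ^ d` cells. -/
noncomputable def subcellCorner {d R : ℕ} (c : Fin d → ℝ) (s : ℝ) (r : Fin d → Fin R) :
    Fin d → ℝ :=
  fun i => c i + s / R * (r i : ℕ)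

/-- The index of the subcell of its dyadic cube of level `ℓ` that contains `y`. -/
noncomputable def subcellIndex {d : ℕ} (b : Fin d → ℝ) (l : ℝ) (R : ℕ) [NeZero R] (ℓ : ℕ)
    (y : Fin d → ℝ) : Fin d → Fin R :=
  fun i => Fin.ofNat R ⌊R * Int.fract ((y i - b i) / (l / 2 ^ ℓ))⌋₊

/-- The dyadic cube of level `ℓ` with index `m` touches the neighbor `hypercube a l`. -/
def CellNear {d : ℕ} (a b : Fin d → ℝ) (l : ℝ) (ℓ : ℕ) (m : Fin d → ℤ) : Prop :=
  ∀ i, (a i + l = b i → m i ≤ 0) ∧ (b i + l = a i → 2 ^ ℓ - 1 ≤ m i)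

open Classical in
/-- The first level at which the dyadic cube of `y` does not touch `hypercube a l`, or `κ + 1` if
there is no such level up to `κ`. -/
noncomputable def farLevel {d : ℕ} (a b : Fin d → ℝ) (l : ℝ) (κ : ℕ) (y : Fin d → ℝ) : ℕ :=
  Nat.find (p := fun ℓ => ¬ CellNear a b l ℓ (dyadicIndex b l ℓ y) ∨ ℓ = κ + 1) ⟨κ + 1, Or.inr rfl⟩

/-- The label of `y`: its dyadic cube of level `farLevel` and its subcell of that cube. -/
noncomputable def cellLabel {d : ℕ} (a b : Fin d → ℝ) (l : ℝ) (R : ℕ) [NeZero R] (κ : ℕ)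
    (y : Fin d → ℝ) : (ℕ × (Fin d → ℤ)) × (Fin d → Fin R) :=
  ((farLevel a b l κ y, dyadicIndex b l (farLevel a b l κ y) y),
    subcellIndex b l R (farLevel a b l κ y) y)

/-- The range of the `i`-th index of the dyadic cubes of level `ℓ` with a parent that touches
`hypercube a l`. -/
noncomputable def indexRange {d : ℕ} (a b : Fin d → ℝ) (l : ℝ) (ℓ : ℕ) (i : Fin d) : Finset ℤ :=
  if a i = b i then Finset.Ico 0 (2 ^ ℓ)
  else if a i + l = b i then Finset.Ico 0 2 else Finset.Ico (2 ^ ℓ - 2) (2 ^ ℓ)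

open Classical in
/-- The dyadic cubes of level at most `κ` that do not touch `hypercube a l` although their parents
do. -/
noncomputable def farCells {d : ℕ} (a b : Fin d → ℝ) (l : ℝ) (κ : ℕ) :
    Finset (ℕ × (Fin d → ℤ)) :=
  (Finset.Icc 1 κ).biUnion fun ℓ =>
    ((Fintype.piFinset (indexRange a b l ℓ)).filter fun m => ¬ CellNear a b l ℓ m).image (Prod.mk ℓ)

theorem mem_farCells {d : ℕ} {a b : Fin d → ℝ} {l : ℝ} {κ ℓ : ℕ} {m : Fin d → ℤ} :
    (ℓ, m) ∈ farCells a b l κ ↔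
      1 ≤ ℓ ∧ ℓ ≤ κ ∧ (∀ i, m i ∈ indexRange a b l ℓ i) ∧ ¬ CellNear a b l ℓ m := by
  simp only [farCells, Finset.mem_biUnion, Finset.mem_Icc, Finset.mem_image, Finset.mem_filter,
    Fintype.mem_piFinset, Prod.mk.injEq]
  constructor
  · rintro ⟨ℓ', h1, m', h2, rfl, rfl⟩
    exact ⟨h1.1, h1.2, h2⟩
  · rintro ⟨h1, h2, h3⟩
    exact ⟨ℓ, ⟨h1, h2⟩, m, h3, rfl, rfl⟩

theorem measurable_cellLabel {d : ℕ} (a b : Fin d → ℝ) (l : ℝ) (R : ℕ) [NeZero R] (κ : ℕ) :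
    Measurable (cellLabel a b l R κ) := by
  have h1 : ∀ ℓ, Measurable (dyadicIndex b l ℓ) := fun ℓ =>
    measurable_pi_lambda _ fun i => Measurable.floor (by fun_prop)
  have h2 : ∀ ℓ, Measurable (subcellIndex b l R ℓ) := fun ℓ =>
    measurable_pi_lambda _ fun i => (Measurable.of_discrete (f := Fin.ofNat R)).comp
      (Nat.measurable_floor.comp (measurable_const.mul (Measurable.fract (by fun_prop))))
  have h3 : Measurable (farLevel a b l κ) := by
    classical
    refine measurable_find _ fun ℓ => MeasurableSet.union ?_ (MeasurableSet.const _)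
    exact h1 ℓ (MeasurableSet.of_discrete (s := {m | ¬ CellNear a b l ℓ m}))
  have h4 : Measurable fun u : ℕ × (Fin d → ℝ) =>
      ((u.1, dyadicIndex b l u.1 u.2), subcellIndex b l R u.1 u.2) :=
    measurable_from_prod_countable_right fun ℓ => (measurable_const.prodMk (h1 ℓ)).prodMk (h2 ℓ)
  exact h4.comp (h3.prodMk measurable_id)

theorem cellNear_dyadicIndex_iff {d : ℕ} {a b : Fin d → ℝ} {l : ℝ} (hl : 0 < l) {ℓ : ℕ}
    {y : Fin d → ℝ} :
    CellNear a b l ℓ (dyadicIndex b l ℓ y) ↔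
      ∀ i, (a i + l = b i → y i - b i < l / 2 ^ ℓ) ∧ (b i + l = a i → l - l / 2 ^ ℓ ≤ y i - b i) := by
  have hh : 0 < l / 2 ^ ℓ := by positivity
  refine forall_congr' fun i => and_congr (imp_congr_right fun _ => ?_)
    (imp_congr_right fun _ => ?_)
  · rw [← Int.lt_add_one_iff, dyadicIndex, zero_add, Int.floor_lt, div_lt_iff₀ hh]
    simp
  · rw [dyadicIndex, Int.le_floor, le_div_iff₀ hh]
    push_cast
    rw [sub_mul, mul_div_cancel₀ _ (by positivity), one_mul]

/-- The strips along `hypercube a l` shrink as the level grows. Hence a near parent already forces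
all earlier ancestors to be near. -/
theorem CellNear.of_le {d : ℕ} {a b : Fin d → ℝ} {l : ℝ} (hl : 0 < l) {ℓ ℓ' : ℕ} (hle : ℓ' ≤ ℓ)
    {y : Fin d → ℝ} (h : CellNear a b l ℓ (dyadicIndex b l ℓ y)) :
    CellNear a b l ℓ' (dyadicIndex b l ℓ' y) := by
  rw [cellNear_dyadicIndex_iff hl] at h ⊢
  have h2 : l / 2 ^ ℓ ≤ l / 2 ^ ℓ' := by
    gcongr
    norm_num
  exact fun i => ⟨fun hi => ((h i).1 hi).trans_le h2, fun hi => by linarith [(h i).2 hi]⟩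

theorem mem_hypercube_of_dyadicIndex_eq {d : ℕ} {b : Fin d → ℝ} {l : ℝ} (hl : 0 < l) {ℓ : ℕ}
    {y : Fin d → ℝ} {m : Fin d → ℤ} (h : dyadicIndex b l ℓ y = m) :
    y ∈ hypercube (dyadicCorner b l (ℓ, m)) (l / 2 ^ ℓ) := by
  subst h
  intro i
  have hh : 0 < l / 2 ^ ℓ := by positivity
  have h1 := Int.floor_le ((y i - b i) / (l / 2 ^ ℓ))
  have h2 := (Int.lt_floor_add_one ((y i - b i) / (l / 2 ^ ℓ))).le
  rw [le_div_iff₀ hh] at h1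
  rw [div_le_iff₀ hh] at h2
  simp only [dyadicCorner, dyadicIndex]
  constructor <;> linarith

theorem mem_hypercube_subcell {d : ℕ} {b : Fin d → ℝ} {l : ℝ} (hl : 0 < l) {R : ℕ} [NeZero R]
    {ℓ : ℕ} {y : Fin d → ℝ} :
    y ∈ hypercube (subcellCorner (dyadicCorner b l (ℓ, dyadicIndex b l ℓ y)) (l / 2 ^ ℓ)
      (subcellIndex b l R ℓ y)) (l / 2 ^ ℓ / R) := by
  intro i
  have hR : (0 : ℝ) < R := by exact_mod_cast NeZero.pos R
  have hh : 0 < l / 2 ^ ℓ := by positivity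
  set h := l / 2 ^ ℓ with h_def
  set u := (y i - b i) / h with hu
  have hy : y i = b i + h * (⌊u⌋ + Int.fract u) := by
    rw [Int.floor_add_fract, hu]
    field_simp
    ring
  have hlt : ⌊R * Int.fract u⌋₊ < R := by
    rw [Nat.floor_lt (by have := Int.fract_nonneg u; positivity)]
    have := Int.fract_lt_one u
    nlinarith
  have hval : ((subcellIndex b l R ℓ y i : ℕ) : ℝ) = ⌊R * Int.fract u⌋₊ := by
    rw [subcellIndex, ← h_def, ← hu, Fin.val_ofNat, Nat.mod_eq_of_lt hlt]
  have h1 : (⌊R * Int.fract u⌋₊ : ℝ) ≤ R * Int.fract u :=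
    Nat.floor_le (by have := Int.fract_nonneg u; positivity)
  have h2 := (Nat.lt_floor_add_one (R * Int.fract u)).le
  have e : h * Int.fract u = h / R * (R * Int.fract u) := by field_simp
  have h3 := mul_le_mul_of_nonneg_left h1 (by positivity : 0 ≤ h / R)
  have h4 := mul_le_mul_of_nonneg_left h2 (by positivity : 0 ≤ h / R)
  have e2 : (dyadicIndex b l ℓ y i : ℝ) = ⌊u⌋ := by rw [dyadicIndex, ← h_def, ← hu]
  simp only [subcellCorner, dyadicCorner]
  rw [hval, hy, ← h_def, e2]
  constructor <;> linarith

theorem dist_le_of_mem_hypercube {d : ℕ} {c : Fin d → ℝ} {s : ℝ} (hs : 0 ≤ s) {y y' : Fin d → ℝ}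
    (hy : y ∈ hypercube c s) (hy' : y' ∈ hypercube c s) : dist y y' ≤ s := by
  rw [dist_pi_le_iff hs]
  intro i
  rw [Real.dist_eq, abs_le]
  have h1 := hy i
  have h2 := hy' i
  constructor <;> linarith

theorem exists_mem_subcell {d : ℕ} {c : Fin d → ℝ} {s : ℝ} (hs : 0 < s) (R : ℕ) [NeZero R]
    {y : Fin d → ℝ} (hy : y ∈ hypercube c s) :
    ∃ r : Fin d → Fin R, y ∈ hypercube (subcellCorner c s r) (s / R) := by
  have hR : (0 : ℝ) < R := by exact_mod_cast NeZero.pos R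
  have hsR : 0 < s / R := by positivity
  have hone : ∀ i, ∃ r : Fin R, c i + s / R * (r : ℕ) ≤ y i ∧ y i ≤ c i + s / R * (r : ℕ) + s / R := by
    intro i
    set u := (y i - c i) / (s / R) with hu
    have hu0 : 0 ≤ u := div_nonneg (sub_nonneg.2 (hy i).1) hsR.le
    have huR : u ≤ R := by
      rw [hu, div_le_iff₀ hsR, mul_div_cancel₀ _ hR.ne']
      linarith [(hy i).2]
    have hyu : y i = c i + s / R * u := by rw [hu, mul_div_cancel₀ _ hsR.ne']; ring
    rw [hyu]
    rcases lt_or_ge ⌊u⌋₊ R with hlt | hge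
    · refine ⟨⟨⌊u⌋₊, hlt⟩, ?_, ?_⟩
      · have := mul_le_mul_of_nonneg_left (Nat.floor_le hu0) hsR.le
        simpa using this
      · have := mul_le_mul_of_nonneg_left (Nat.lt_floor_add_one u).le hsR.le
        simp only
        linarith
    -- Only the upper face of the closed cube gets here; it belongs to the last subcell.
    · have hRu : (R : ℝ) ≤ u := (Nat.le_floor_iff hu0).1 hge
      have hR1 : 1 ≤ R := NeZero.pos R
      refine ⟨⟨R - 1, by omega⟩, ?_, ?_⟩
      · simp only [Nat.cast_sub hR1, Nat.cast_one]
        nlinarith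
      · simp only [Nat.cast_sub hR1, Nat.cast_one]
        nlinarith
  choose r hr using hone
  exact ⟨r, hr⟩

theorem indexRange_subset {d : ℕ} {a b : Fin d → ℝ} {l : ℝ} {ℓ : ℕ} (hℓ : 1 ≤ ℓ) {i : Fin d} {z : ℤ}
    (h : z ∈ indexRange a b l ℓ i) : 0 ≤ z ∧ z + 1 ≤ 2 ^ ℓ := by
  have h2 : (2 : ℤ) ≤ 2 ^ ℓ := by
    calc (2 : ℤ) = 2 ^ 1 := by norm_num
      _ ≤ 2 ^ ℓ := pow_le_pow_right₀ (by norm_num) hℓ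
  unfold indexRange at h
  split_ifs at h <;> rw [Finset.mem_Ico] at h <;> omega

theorem hypercube_dyadicCorner_subset {d : ℕ} {a b : Fin d → ℝ} {l : ℝ} (hl : 0 < l) {κ : ℕ}
    {q : ℕ × (Fin d → ℤ)} (hq : q ∈ farCells a b l κ) :
    hypercube (dyadicCorner b l q) (l / 2 ^ q.1) ⊆ hypercube b l := by
  obtain ⟨ℓ, m⟩ := q
  obtain ⟨h1, -, h2, -⟩ := mem_farCells.1 hq
  intro y hy i
  have hh : 0 < l / 2 ^ ℓ := by positivity
  obtain ⟨h3, h4⟩ := indexRange_subset h1 (h2 i)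
  have h3' : (0 : ℝ) ≤ m i := by exact_mod_cast h3
  have h4' : (m i : ℝ) + 1 ≤ 2 ^ ℓ := by exact_mod_cast h4
  have h5 := mul_le_mul_of_nonneg_left h4' hh.le
  rw [div_mul_cancel₀ _ (by positivity)] at h5
  have h6 := mul_nonneg hh.le h3'
  have := hy i
  simp only [dyadicCorner] at this
  constructor <;> linarith

/-- In a coordinate where the cell fails to touch, at least one full cell width separates it from
`hypercube a l`, and the maximum norm sees this coordinate. -/
theorem farFrom_dyadicCorner {d : ℕ} {a b : Fin d → ℝ} {l : ℝ} (hl : 0 < l) {κ : ℕ}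
    {q : ℕ × (Fin d → ℤ)} (hq : q ∈ farCells a b l κ) :
    FarFrom (hypercube a l) (dyadicCorner b l q) (l / 2 ^ q.1) := by
  obtain ⟨ℓ, m⟩ := q
  obtain ⟨-, -, -, hfar⟩ := mem_farCells.1 hq
  intro x hx y hy
  have hh : 0 < l / 2 ^ ℓ := by positivity
  simp only [CellNear, not_forall] at hfar
  obtain ⟨i, hi⟩ := hfar
  refine le_trans ?_ (dist_le_pi_dist x y i)
  rw [Real.dist_eq]
  have hyi := hy i
  have hxi := hx i
  simp only [dyadicCorner] at hyi ⊢
  rw [not_and_or] at hi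
  push Not at hi
  rcases hi with ⟨hi, hm⟩ | ⟨hi, hm⟩
  · have hm' : (1 : ℝ) ≤ m i := by exact_mod_cast hm
    have := mul_le_mul_of_nonneg_left hm' hh.le
    rw [abs_sub_comm]
    refine le_trans ?_ (le_abs_self _)
    linarith
  · have hm' : (m i : ℝ) ≤ 2 ^ ℓ - 2 := by
      have : m i ≤ 2 ^ ℓ - 2 := by omega
      exact_mod_cast this
    have := mul_le_mul_of_nonneg_left hm' hh.le
    rw [mul_sub, div_mul_cancel₀ _ (by positivity)] at this
    refine le_trans ?_ (le_abs_self _)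
    linarith

theorem farLevel_eq_iff {d : ℕ} {a b : Fin d → ℝ} {l : ℝ} {κ ℓ : ℕ} {y : Fin d → ℝ} (hℓ : ℓ ≤ κ) :
    farLevel a b l κ y = ℓ ↔ ¬ CellNear a b l ℓ (dyadicIndex b l ℓ y) ∧
      ∀ ℓ' < ℓ, CellNear a b l ℓ' (dyadicIndex b l ℓ' y) := by
  classical
  unfold farLevel
  rw [Nat.find_eq_iff]
  refine and_congr (by simp; omega) (forall₂_congr fun ℓ' h => ?_)
  simp
  omega

/-- Otherwise the first level with a cube that does not touch is at most `κ`. The parent at that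
level touches, which confines the index to `indexRange` and makes the cube a far cell. -/
theorem cellNear_of_notMem_farCells {d d' : ℕ} {a b : Fin d → ℝ} {l : ℝ} (hl : 0 < l)
    (hab : ShareHypersurface a b l d') {κ : ℕ} {y : Fin d → ℝ}
    (hy0 : ∀ i, b i < y i) (hy1 : ∀ i, y i < b i + l)
    (h : (farLevel a b l κ y, dyadicIndex b l (farLevel a b l κ y) y) ∉ farCells a b l κ) :
    CellNear a b l κ (dyadicIndex b l κ y) := by
  by_contra hnear
  apply h
  have hle : farLevel a b l κ y ≤ κ := by
    classical
    exact Nat.find_min' _ (Or.inl hnear)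
  obtain ⟨hfar, hmin⟩ := (farLevel_eq_iff hle).1 rfl
  set ℓ := farLevel a b l κ y
  -- The cube of level `0` is `Y` itself, which touches, so a parent exists.
  have hℓ : 1 ≤ ℓ := by
    by_contra h0
    have h0' : ℓ = 0 := by omega
    rw [h0'] at hfar
    refine hfar ((cellNear_dyadicIndex_iff hl).2 fun i => ⟨fun _ => ?_, fun _ => ?_⟩)
    · simp only [pow_zero, div_one]
      linarith [hy1 i]
    · simp only [pow_zero, div_one]
      linarith [hy0 i]
  refine mem_farCells.2 ⟨hℓ, hle, fun i => ?_, hfar⟩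
  have hh : 0 < l / 2 ^ ℓ := by positivity
  have hparent := (cellNear_dyadicIndex_iff hl).1 (hmin (ℓ - 1) (by omega)) i
  have hdouble : l / 2 ^ (ℓ - 1) = 2 * (l / 2 ^ ℓ) := by
    obtain ⟨ℓ₀, h0⟩ : ∃ ℓ₀, ℓ = ℓ₀ + 1 := ⟨ℓ - 1, by omega⟩
    rw [h0, Nat.add_sub_cancel, pow_succ]
    field_simp
  rw [hdouble] at hparent
  have hcancel : 2 ^ ℓ * (l / 2 ^ ℓ) = l := mul_div_cancel₀ _ (by positivity)
  have h0 : 0 ≤ dyadicIndex b l ℓ y i :=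
    Int.floor_nonneg.2 (div_nonneg (by linarith [hy0 i]) hh.le)
  have h1 : dyadicIndex b l ℓ y i < 2 ^ ℓ := by
    rw [dyadicIndex, Int.floor_lt, div_lt_iff₀ hh]
    push_cast
    rw [hcancel]
    linarith [hy1 i]
  unfold indexRange
  split_ifs with hi1 hi2
  · exact Finset.mem_Ico.2 ⟨h0, h1⟩
  · refine Finset.mem_Ico.2 ⟨h0, ?_⟩
    rw [dyadicIndex, Int.floor_lt, div_lt_iff₀ hh]
    exact_mod_cast hparent.1 hi2
  · have hi3 := ((hab.1 i).resolve_left hi1).resolve_left hi2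
    refine Finset.mem_Ico.2 ⟨?_, h1⟩
    rw [dyadicIndex, Int.le_floor, le_div_iff₀ hh]
    push_cast
    rw [sub_mul, hcancel]
    exact hparent.2 hi3

/-- The half-open subcell determines both floors, and `indexRange` says that the parent touches, so
no earlier level stops. This gives the lower bound for the probability of a label. -/
theorem cellLabel_eq {d : ℕ} {a b : Fin d → ℝ} {l : ℝ} (hl : 0 < l) {R : ℕ} [NeZero R] {κ : ℕ}
    {q : ℕ × (Fin d → ℤ)} (hq : q ∈ farCells a b l κ) {r : Fin d → Fin R} {y : Fin d → ℝ}
    (hy : ∀ i, y i ∈ Set.Ico (subcellCorner (dyadicCorner b l q) (l / 2 ^ q.1) r i)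
      (subcellCorner (dyadicCorner b l q) (l / 2 ^ q.1) r i + l / 2 ^ q.1 / R)) :
    cellLabel a b l R κ y = (q, r) := by
  obtain ⟨ℓ, m⟩ := q
  obtain ⟨hℓ, hℓκ, hm, hfar⟩ := mem_farCells.1 hq
  have hR : (0 : ℝ) < R := by exact_mod_cast NeZero.pos R
  have hh : 0 < l / 2 ^ ℓ := by positivity
  simp only [subcellCorner, dyadicCorner] at hy
  have hcoord : ∀ i, ⌊(y i - b i) / (l / 2 ^ ℓ)⌋ = m i ∧
      ⌊R * Int.fract ((y i - b i) / (l / 2 ^ ℓ))⌋₊ = (r i : ℕ) := by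
    intro i
    obtain ⟨h1, h2⟩ := hy i
    set u := (y i - b i) / (l / 2 ^ ℓ) with hu
    have hyu : y i = b i + l / 2 ^ ℓ * u := by rw [hu, mul_div_cancel₀ _ hh.ne']; ring
    have h3 : (r i : ℕ) ≤ R * (u - m i) := by
      have : l / 2 ^ ℓ / R * (r i : ℕ) ≤ l / 2 ^ ℓ / R * (R * (u - m i)) := by
        have : l / 2 ^ ℓ / R * (R * (u - m i)) = l / 2 ^ ℓ * (u - m i) := by field_simp
        rw [this]
        linarith
      exact le_of_mul_le_mul_left this (by positivity)
    have h4 : R * (u - m i) < (r i : ℕ) + 1 := by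
      have : l / 2 ^ ℓ / R * (R * (u - m i)) < l / 2 ^ ℓ / R * ((r i : ℕ) + 1) := by
        have : l / 2 ^ ℓ / R * (R * (u - m i)) = l / 2 ^ ℓ * (u - m i) := by field_simp
        rw [this]
        linarith
      exact lt_of_mul_lt_mul_left this (by positivity)
    have hrR : ((r i : ℕ) : ℝ) + 1 ≤ R := by exact_mod_cast (r i).isLt
    have hfl : ⌊u⌋ = m i := by
      rw [Int.floor_eq_iff]
      have h5 : 0 ≤ u - m i :=
        nonneg_of_mul_nonneg_right (le_trans (Nat.cast_nonneg _) h3) hR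
      have h6 : R * (u - m i) < R * 1 := by linarith
      have := lt_of_mul_lt_mul_left h6 hR.le
      constructor <;> linarith
    refine ⟨hfl, ?_⟩
    have hfr : Int.fract u = u - m i := by rw [Int.fract, hfl]
    rw [hfr, Nat.floor_eq_iff (le_trans (Nat.cast_nonneg _) h3)]
    exact ⟨h3, h4⟩
  have hidx : dyadicIndex b l ℓ y = m := funext fun i => (hcoord i).1
  have hsub : subcellIndex b l R ℓ y = r := by
    funext i
    rw [subcellIndex, (hcoord i).2]
    exact Fin.ext (by rw [Fin.val_ofNat, Nat.mod_eq_of_lt (r i).isLt])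
  have hparent : CellNear a b l (ℓ - 1) (dyadicIndex b l (ℓ - 1) y) := by
    rw [cellNear_dyadicIndex_iff hl]
    have hdouble : l / 2 ^ (ℓ - 1) = 2 * (l / 2 ^ ℓ) := by
      obtain ⟨ℓ₀, rfl⟩ : ∃ ℓ₀, ℓ = ℓ₀ + 1 := ⟨ℓ - 1, by omega⟩
      rw [Nat.add_sub_cancel, pow_succ]
      field_simp
    have hcancel : 2 ^ ℓ * (l / 2 ^ ℓ) = l := mul_div_cancel₀ _ (by positivity)
    rw [hdouble]
    intro i
    have hmi := hm i
    rw [← hidx] at hmi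
    unfold indexRange at hmi
    constructor
    · intro hi
      have hne : a i ≠ b i := by intro h; linarith
      rw [if_neg hne, if_pos hi, Finset.mem_Ico] at hmi
      have := hmi.2
      rw [dyadicIndex, Int.floor_lt, div_lt_iff₀ hh] at this
      exact_mod_cast this
    · intro hi
      have hne : a i ≠ b i := by intro h; linarith
      have hne' : a i + l ≠ b i := by intro h; linarith
      rw [if_neg hne, if_neg hne', Finset.mem_Ico] at hmi
      have := hmi.1
      rw [dyadicIndex, Int.le_floor, le_div_iff₀ hh] at this
      push_cast at this
      rw [sub_mul, hcancel] at this
      exact this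
  have hlev : farLevel a b l κ y = ℓ := by
    rw [farLevel_eq_iff hℓκ, hidx]
    exact ⟨hfar, fun ℓ' hℓ' => hparent.of_le hl (by omega)⟩
  rw [cellLabel, hlev, hidx, hsub]

theorem card_farCells_le {d d' : ℕ} {a b : Fin d → ℝ} {l : ℝ} (hab : ShareHypersurface a b l d')
    (κ : ℕ) : (farCells a b l κ).card ≤ ∑ ℓ ∈ Finset.Icc 1 κ, (2 ^ ℓ) ^ d' * 2 ^ d := by
  classical
  refine Finset.card_biUnion_le.trans (Finset.sum_le_sum fun ℓ _ => ?_)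
  refine Finset.card_image_le.trans ((Finset.card_filter_le _ _).trans ?_)
  rw [Fintype.card_piFinset]
  -- The factor `2` is superfluous in the coinciding coordinates, but makes the product the uniform
  -- `2 ^ d`.
  have hc : ∀ i, (indexRange a b l ℓ i).card ≤ (if a i = b i then 2 ^ ℓ else 1) * 2 := by
    intro i
    unfold indexRange
    split_ifs <;> simp
  refine (Finset.prod_le_prod' fun i _ => hc i).trans (le_of_eq ?_)
  rw [Finset.prod_mul_distrib, Finset.prod_ite, Finset.prod_const, hab.2]
  simp

/-! ### Probabilities of cells and labels for a uniform point -/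

theorem volume_hypercube {d : ℕ} (c : Fin d → ℝ) (s : ℝ) :
    volume (hypercube c s) = ENNReal.ofReal s ^ d := by
  rw [hypercube_eq_Icc, Real.volume_Icc_pi]
  simp

theorem interior_hypercube {d : ℕ} (c : Fin d → ℝ) (s : ℝ) :
    interior (hypercube c s) = {y | ∀ i, c i < y i ∧ y i < c i + s} := by
  have : hypercube c s = Set.univ.pi fun i => Set.Icc (c i) (c i + s) := by
    ext y
    exact ⟨fun h i _ => h i, fun h i => h i trivial⟩
  rw [this, interior_pi_set Set.finite_univ]
  ext y
  simp

/-- The probability of an event for a uniform point of a cube. -/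
theorem measureReal_preimage_of_isUniform {Ω : Type*} [MeasurableSpace Ω] {P : Measure Ω} {d : ℕ}
    {c : Fin d → ℝ} {l : ℝ} (hl : 0 < l) {z : Ω → Fin d → ℝ}
    (hz : pdf.IsUniform z (hypercube c l) P volume) {A : Set (Fin d → ℝ)} (hA : MeasurableSet A) :
    P.real (z ⁻¹' A) = volume.real (hypercube c l ∩ A) / l ^ d := by
  have hv := volume_hypercube c l
  have h0 : ENNReal.ofReal l ^ d ≠ 0 := pow_ne_zero _ (by simpa using hl)
  rw [Measure.real, hz.measure_preimage (by rw [hv]; exact h0) (by rw [hv]; finiteness) hA,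
    ENNReal.toReal_div, hv, ENNReal.toReal_pow, ENNReal.toReal_ofReal hl.le, Measure.real]

theorem ae_mem_interior_of_isUniform {Ω : Type*} [MeasurableSpace Ω] {P : Measure Ω} {d : ℕ}
    {c : Fin d → ℝ} {l : ℝ} (hl : 0 < l) {z : Ω → Fin d → ℝ}
    (hz : pdf.IsUniform z (hypercube c l) P volume) :
    ∀ᵐ ω ∂P, z ω ∈ interior (hypercube c l) := by
  have hv := volume_hypercube c l
  have h0 : ENNReal.ofReal l ^ d ≠ 0 := pow_ne_zero _ (by simpa using hl)
  have hconv : Convex ℝ (hypercube c l) := by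
    rw [hypercube_eq_Icc]
    exact convex_Icc _ _
  have := hz.measure_preimage (by rw [hv]; exact h0) (by rw [hv]; finiteness)
    (isOpen_interior (s := hypercube c l)).measurableSet.compl
  have hfr : hypercube c l ∩ (interior (hypercube c l))ᶜ ⊆ frontier (hypercube c l) :=
    fun y hy => ⟨subset_closure hy.1, hy.2⟩
  rw [measure_mono_null hfr (hconv.addHaar_frontier volume), ENNReal.zero_div] at this
  exact this

section Probabilities

variable {Ω : Type*} [MeasurableSpace Ω] {P : Measure Ω} [IsProbabilityMeasure P] {d d' : ℕ}
  {a b : Fin d → ℝ} {l : ℝ} {z : Ω → Fin d → ℝ} {κ : ℕ}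

theorem le_measureReal_cellLabel_eq (hl : 0 < l)
    (hz : pdf.IsUniform z (hypercube b l) P volume)
    {R : ℕ} [NeZero R] {q : ℕ × (Fin d → ℤ)} (hq : q ∈ farCells a b l κ) (r : Fin d → Fin R) :
    (1 / (2 ^ q.1 * R) : ℝ) ^ d ≤ P.real {ω | cellLabel a b l R κ (z ω) = (q, r)} := by
  have hR : (0 : ℝ) < R := by exact_mod_cast NeZero.pos R
  have hsR : 0 < l / 2 ^ q.1 / R := by positivity
  set c := subcellCorner (dyadicCorner b l q) (l / 2 ^ q.1) r with hc
  set S : Set (Fin d → ℝ) := Set.univ.pi fun i => Set.Ico (c i) (c i + l / 2 ^ q.1 / R) with hS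
  have hSm : MeasurableSet S := MeasurableSet.univ_pi fun i => measurableSet_Ico
  have hSQ : S ⊆ hypercube (dyadicCorner b l q) (l / 2 ^ q.1) := by
    intro y hy i
    have hyi := hy i (Set.mem_univ i)
    simp only [hc, subcellCorner] at hyi
    have h1 : 0 ≤ l / 2 ^ q.1 / R * (r i : ℕ) := by positivity
    have h2 : l / 2 ^ q.1 / R * ((r i : ℕ) + 1) ≤ l / 2 ^ q.1 / R * R := by
      gcongr
      exact_mod_cast (r i).isLt
    rw [div_mul_cancel₀ _ hR.ne'] at h2
    exact ⟨by linarith [hyi.1], by linarith [hyi.2]⟩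
  have hSY : S ⊆ hypercube b l := hSQ.trans (hypercube_dyadicCorner_subset hl hq)
  have hsub : z ⁻¹' S ⊆ {ω | cellLabel a b l R κ (z ω) = (q, r)} := fun ω hω =>
    cellLabel_eq hl hq fun i => hω i (Set.mem_univ i)
  refine le_trans (le_of_eq ?_) (measureReal_mono hsub)
  rw [measureReal_preimage_of_isUniform hl hz hSm, Set.inter_eq_right.2 hSY, Measure.real, hS,
    Real.volume_pi_Ico]
  simp only [add_sub_cancel_left, Finset.prod_const, Finset.card_univ, Fintype.card_fin,
    ENNReal.toReal_pow, ENNReal.toReal_ofReal hsR.le]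
  rw [← div_pow]
  congr 1
  field_simp

theorem measureReal_cellLabel_fst_eq_le (hl : 0 < l)
    (hz : pdf.IsUniform z (hypercube b l) P volume)
    {R : ℕ} [NeZero R] (q : ℕ × (Fin d → ℤ)) :
    P.real {ω | (cellLabel a b l R κ (z ω)).1 = q} ≤ (1 / 2 ^ q.1 : ℝ) ^ d := by
  have hh : 0 < l / 2 ^ q.1 := by positivity
  set Q := hypercube (dyadicCorner b l q) (l / 2 ^ q.1)
  have hsub : {ω | (cellLabel a b l R κ (z ω)).1 = q} ⊆ z ⁻¹' Q := by
    rintro ω rfl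
    exact mem_hypercube_of_dyadicIndex_eq hl rfl
  refine (measureReal_mono hsub).trans ?_
  rw [measureReal_preimage_of_isUniform hl hz (isCompact_hypercube _ _).measurableSet,
    show (1 / 2 ^ q.1 : ℝ) ^ d = (l / 2 ^ q.1) ^ d / l ^ d by
      rw [← div_pow]; congr 1; field_simp]
  gcongr
  refine (measureReal_mono Set.inter_subset_right ?_).trans (le_of_eq ?_)
  · rw [volume_hypercube]
    finiteness
  · rw [Measure.real, volume_hypercube, ENNReal.toReal_pow, ENNReal.toReal_ofReal hh.le]

/-- Almost surely such a point lies in a box around the shared face, of width `l / 2 ^ κ` in the `d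
- d'` adjacent coordinates and `l` in the others. -/
theorem measureReal_cellLabel_notMem_le (hl : 0 < l) (hab : ShareHypersurface a b l d')
    (hz : pdf.IsUniform z (hypercube b l) P volume) {R : ℕ} [NeZero R] :
    P.real {ω | (cellLabel a b l R κ (z ω)).1 ∉ farCells a b l κ} ≤
      (1 / 2 ^ κ : ℝ) ^ (d - d') := by
  have hh : 0 < l / 2 ^ κ := by positivity
  set lo : Fin d → ℝ := fun i => if b i + l = a i then b i + l - l / 2 ^ κ else b i with hlo
  set hi : Fin d → ℝ := fun i => if a i + l = b i then b i + l / 2 ^ κ else b i + l with hhi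
  have hsub : ∀ᵐ ω ∂P, ω ∈ {ω | (cellLabel a b l R κ (z ω)).1 ∉ farCells a b l κ} →
      ω ∈ z ⁻¹' Set.Icc lo hi := by
    filter_upwards [ae_mem_interior_of_isUniform hl hz] with ω hω hfar
    rw [interior_hypercube] at hω
    have hnear := (cellNear_dyadicIndex_iff hl).1 (cellNear_of_notMem_farCells hl hab
      (fun i => (hω i).1) (fun i => (hω i).2) hfar)
    refine ⟨fun i => ?_, fun i => ?_⟩
    · simp only [hlo]
      split_ifs with h
      · linarith [(hnear i).2 h]
      · exact (hω i).1.le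
    · simp only [hhi]
      split_ifs with h
      · linarith [(hnear i).1 h]
      · exact (hω i).2.le
  have hle : P.real {ω | (cellLabel a b l R κ (z ω)).1 ∉ farCells a b l κ} ≤
      P.real (z ⁻¹' Set.Icc lo hi) :=
    ENNReal.toReal_mono (measure_ne_top _ _) (measure_mono_ae hsub)
  refine hle.trans ?_
  rw [measureReal_preimage_of_isUniform hl hz measurableSet_Icc]
  have hlen : ∀ i, hi i - lo i = l * (if a i = b i then 1 else 1 / 2 ^ κ) := by
    intro i
    simp only [hhi, hlo]
    rcases hab.1 i with h | h | h
    · rw [if_neg (by intro h'; linarith), if_neg (by intro h'; linarith), if_pos h]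
      ring
    · rw [if_pos h, if_neg (by intro h'; linarith), if_neg (by intro h'; linarith)]
      ring
    · rw [if_neg (by intro h'; linarith), if_pos h, if_neg (by intro h'; linarith)]
      ring
  have hvol : volume.real (Set.Icc lo hi) = l ^ d * (1 / 2 ^ κ) ^ (d - d') := by
    rw [Measure.real, Real.volume_Icc_pi, ENNReal.toReal_prod]
    simp_rw [hlen]
    rw [Finset.prod_congr rfl fun i _ => ENNReal.toReal_ofReal (by split_ifs <;> positivity),
      Finset.prod_mul_distrib, Finset.prod_const, Finset.prod_ite, Finset.prod_const_one,
      Finset.prod_const, one_mul, Finset.card_univ, Fintype.card_fin]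
    congr 2
    have := Finset.card_filter_add_card_filter_not (s := Finset.univ) (fun i => a i = b i)
    rw [hab.2, Finset.card_univ, Fintype.card_fin] at this
    omega
  rw [div_le_iff₀ (by positivity), mul_comm, ← hvol]
  exact measureReal_mono Set.inter_subset_right isCompact_Icc.measure_lt_top.ne

end Probabilities

/-! ### Rank and accuracy of the approximation -/

open Classical in
theorem rank_submatrix_le_card_image {𝕜 ι κ : Type*} [RCLike 𝕜] [Fintype ι] [Fintype κ]
    (A : Matrix ι κ 𝕜) (σ : κ → κ) :
    (A.submatrix id σ).rank ≤ (Finset.univ.image σ).card := by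
  have h : A.submatrix id σ = (A.submatrix id ((↑) : Finset.univ.image σ → κ)).submatrix id
      (fun j => ⟨σ j, Finset.mem_image_of_mem σ (Finset.mem_univ j)⟩) := by
    ext i j
    rfl
  rw [h]
  refine (Matrix.rank_submatrix_le _ _ _).trans ((Matrix.rank_le_card_width _).trans ?_)
  exact (Fintype.card_coe _).le

theorem norm_le_maxNorm {𝕜 : Type*} [RCLike 𝕜] {n : ℕ} (A : Matrix (Fin n) (Fin n) 𝕜)
    (i j : Fin n) : ‖A i j‖ ≤ maxNorm A :=
  le_ciSup (f := fun ij : Fin n × Fin n => ‖A ij.1 ij.2‖) (Set.finite_range _).bddAbove (i, j)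

theorem maxNorm_pos {𝕜 : Type*} [RCLike 𝕜] {n : ℕ} {A : Matrix (Fin n) (Fin n) 𝕜} (hA : A ≠ 0) :
    0 < maxNorm A := by
  by_contra h
  refine hA (Matrix.ext fun i j => norm_le_zero_iff.1 ((norm_le_maxNorm A i j).trans ?_))
  exact not_lt.1 h

/-- The kernel matrix with the columns replaced by those of the cell representatives is accurate. -/
theorem relErrorLT_submatrix_cellRepresentative {𝕜 : Type*} [RCLike 𝕜] {d n : ℕ}
    [Nonempty (Fin n)]
    {a b : Fin d → ℝ} {l : ℝ} (hl : 0 < l)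
    {k : (Fin d → ℝ) → (Fin d → ℝ) → 𝕜} {δ : ℝ} (hδ : 0 < δ) {R : ℕ} [NeZero R]
    (hR : ∀ (c : Fin d → ℝ) (s : ℝ), 0 < s → hypercube c s ⊆ hypercube b l →
      FarFrom (hypercube a l) c s →
      ∀ x ∈ interior (hypercube a l), ∀ T ⊆ hypercube c s ∩ interior (hypercube b l),
      (∀ y ∈ hypercube c s, ∃ t ∈ T, dist y t ≤ s / R) →
      ∀ A : ℝ, (∀ t ∈ T, ‖k x t‖ ≤ A) →
      ∀ y ∈ hypercube c s ∩ interior (hypercube b l),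
      ∀ y' ∈ hypercube c s ∩ interior (hypercube b l), dist y y' ≤ s / R →
        ‖k x y - k x y'‖ ≤ δ / 2 * A)
    (κ : ℕ) {x y : Fin n → Fin d → ℝ} (hx : ∀ i, x i ∈ interior (hypercube a l))
    (hy : ∀ j, y j ∈ interior (hypercube b l)) :
    RelErrorLT (kernelMatrix k x y) ((kernelMatrix k x y).submatrix id
      (cellRepresentative (farCells a b l κ) fun j => cellLabel a b l R κ (y j))) δ := by
  set K := kernelMatrix k x y with hK
  set lam := fun j => cellLabel a b l R κ (y j) with hlam
  refine ⟨fun h0 => by rw [h0]; rfl, fun h0 => ?_⟩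
  have hpos := maxNorm_pos h0
  rw [div_lt_iff₀ hpos]
  -- The mesh was chosen for `δ / 2` so that the final inequality is strict.
  suffices h : maxNorm (K - K.submatrix id (cellRepresentative (farCells a b l κ) lam)) ≤
      δ / 2 * maxNorm K by
    have := mul_pos hδ hpos
    linarith
  refine ciSup_le fun ⟨i, j⟩ => ?_
  simp only [Matrix.sub_apply, Matrix.submatrix_apply, id_eq]
  rcases cellRepresentative_spec (farCells a b l κ) lam j with h | ⟨hG, hocc, heq⟩
  · rw [h, sub_self, norm_zero]
    positivity
  set j' := cellRepresentative (farCells a b l κ) lam j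
  set q := (lam j).1 with hq
  have hs : 0 < l / 2 ^ q.1 := by positivity
  have hRpos : (0 : ℝ) < R := by exact_mod_cast NeZero.pos R
  have hsR : 0 ≤ l / 2 ^ q.1 / R := by positivity
  have hcell : ∀ j₁, (lam j₁).1 = q → y j₁ ∈ hypercube (dyadicCorner b l q) (l / 2 ^ q.1) := by
    rintro j₁ h₁
    rw [← h₁]
    exact mem_hypercube_of_dyadicIndex_eq hl rfl
  have hsubcell : ∀ j₁ r, lam j₁ = (q, r) →
      y j₁ ∈ hypercube (subcellCorner (dyadicCorner b l q) (l / 2 ^ q.1) r) (l / 2 ^ q.1 / R) := by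
    rintro j₁ r h₁
    have h₂ : q = (lam j₁).1 := by rw [h₁]
    have h₃ : r = (lam j₁).2 := by rw [h₁]
    rw [h₂, h₃]
    exact mem_hypercube_subcell hl
  -- The sample consists of all sources in the cell. It is dense because every subcell is occupied,
  -- and its values are entries of row `i`, hence at most `maxNorm K`.
  refine hR _ _ hs (hypercube_dyadicCorner_subset hl hG) (farFrom_dyadicCorner hl hG) (x i) (hx i)
    (y '' {j₁ | (lam j₁).1 = q}) ?_ ?_ (maxNorm K) ?_ (y j) ⟨hcell j rfl, hy j⟩ (y j')
    ⟨hcell j' (by rw [heq]), hy j'⟩ ?_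
  · rintro _ ⟨j₁, h₁, rfl⟩
    exact ⟨hcell j₁ h₁, hy j₁⟩
  · intro u hu
    obtain ⟨r, hr⟩ := exists_mem_subcell hs R hu
    obtain ⟨j₁, h₁⟩ := hocc r
    exact ⟨y j₁, ⟨j₁, by rw [Set.mem_ofPred_eq, h₁], rfl⟩,
      dist_le_of_mem_hypercube hsR hr (hsubcell j₁ r h₁)⟩
  · rintro _ ⟨j₁, -, rfl⟩
    exact norm_le_maxNorm K i j₁
  · exact dist_le_of_mem_hypercube hsR (hsubcell j _ rfl) (hsubcell j' _ heq)

/-! ### Choice of the depth and counting of the cells -/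

/-- At depth `Nat.log (2 ^ d) n` the number of cells equals the number of points up to a factor `2 ^
d`, which balances far cells against near points. -/
theorem natLog_two_pow_bounds {d n : ℕ} (hd : 0 < d) (hn : n ≠ 0) :
    ((2 : ℝ) ^ Nat.log (2 ^ d) n) ^ d ≤ n ∧ (n : ℝ) ≤ 2 ^ d * (2 ^ Nat.log (2 ^ d) n) ^ d := by
  have h1 := Nat.pow_log_le_self (2 ^ d) hn
  have h2 := (Nat.lt_pow_succ_log_self (Nat.one_lt_two_pow hd.ne') n).le
  constructor
  · rw [← pow_mul, mul_comm, pow_mul]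
    exact_mod_cast h1
  · rw [← pow_mul, mul_comm _ d, pow_mul, ← pow_succ']
    exact_mod_cast h2

/-- The number of far cells and the expected number of points near `hypercube a l`, in the case of a
shared vertex. -/
theorem card_farCells_add_le_logb {d n : ℕ} (hd : 0 < d) (hn : 2 ≤ n) {a b : Fin d → ℝ} {l p : ℝ}
    (hab : ShareHypersurface a b l 0) (hp : 1 ≤ p) :
    (farCells a b l (Nat.log (2 ^ d) n)).card * p +
      n * (1 / 2 ^ Nat.log (2 ^ d) n : ℝ) ^ (d - 0) ≤
      2 ^ d * (3 + d) * (p * Real.logb (2 ^ d) n) := by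
  obtain ⟨-, h2⟩ := natLog_two_pow_bounds (n := n) hd (by omega)
  have hlog := Real.natLog_le_logb n (2 ^ d)
  have hcard := card_farCells_le hab (Nat.log (2 ^ d) n)
  set κ := Nat.log (2 ^ d) n
  have hcard' : ((farCells a b l κ).card : ℝ) ≤ κ * 2 ^ d := by
    have : (farCells a b l κ).card ≤ κ * 2 ^ d := by simpa using hcard
    exact_mod_cast this
  have hnear : (n : ℝ) * (1 / 2 ^ κ : ℝ) ^ (d - 0) ≤ 2 ^ d := by
    rw [Nat.sub_zero, div_pow, one_pow, mul_one_div, div_le_iff₀ (by positivity)]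
    exact h2
  push_cast at hlog
  -- Since `n ≥ 2`, the logarithm is at least `1 / d`, so it absorbs the bounded number of near
  -- points; hence the `d` in the constant.
  have hlb : 1 ≤ d * Real.logb (2 ^ d) n := by
    have hb : (1 : ℝ) < 2 ^ d := one_lt_pow₀ (by norm_num) hd.ne'
    rw [← Real.logb_pow, ← Real.logb_self_eq_one hb]
    refine Real.logb_le_logb_of_le hb (by positivity) ?_
    gcongr
    exact_mod_cast hn
  have h0 : 0 ≤ Real.logb (2 ^ d) n := (Nat.cast_nonneg _).trans hlog
  calc _ ≤ (Real.logb (2 ^ d) n * 2 ^ d) * p + 2 ^ d * (d * Real.logb (2 ^ d) n * p) := by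
        refine add_le_add ?_ ?_
        · gcongr
          exact hcard'.trans (by gcongr)
        · refine hnear.trans (le_mul_of_one_le_right (by positivity) ?_)
          nlinarith
    _ ≤ _ := by
        have : 0 ≤ 2 ^ d * p * Real.logb (2 ^ d) n := by positivity
        nlinarith

/-- The number of far cells and the expected number of points near `hypercube a l`, in the case of a
shared face of positive dimension. -/
theorem card_farCells_add_le_rpow {d d' n : ℕ} (hd : d' < d) (hd' : d' ≠ 0) (hn : 2 ≤ n)
    {a b : Fin d → ℝ} {l p : ℝ} (hab : ShareHypersurface a b l d') (hp : 1 ≤ p) :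
    (farCells a b l (Nat.log (2 ^ d) n)).card * p +
      n * (1 / 2 ^ Nat.log (2 ^ d) n : ℝ) ^ (d - d') ≤
      2 ^ d * (3 + d) * (p * (n : ℝ) ^ ((d' : ℝ) / d)) := by
  obtain ⟨h1, h2⟩ := natLog_two_pow_bounds (d := d) (n := n) (by omega) (by omega)
  have hcard := card_farCells_le hab (Nat.log (2 ^ d) n)
  set κ := Nat.log (2 ^ d) n
  have hd0 : (0 : ℝ) < d := by exact_mod_cast (by omega : 0 < d)
  have hpow : ((2 : ℝ) ^ κ) ^ d' ≤ (n : ℝ) ^ ((d' : ℝ) / d) := by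
    calc ((2 : ℝ) ^ κ) ^ d' = (((2 : ℝ) ^ κ) ^ d) ^ ((d' : ℝ) / d) := by
          rw [← Real.rpow_natCast _ d, ← Real.rpow_mul (by positivity), mul_div_cancel₀ _ hd0.ne',
            Real.rpow_natCast]
      _ ≤ _ := Real.rpow_le_rpow (by positivity) h1 (by positivity)
  -- For `d' ≠ 0` the ratio `2 ^ d'` is at least `2`, so the sum is at most twice its last term.
  have hgeom : ∀ κ : ℕ, ∑ ℓ ∈ Finset.Icc 1 κ, (2 ^ ℓ) ^ d' * 2 ^ d ≤ 2 * (2 ^ κ) ^ d' * 2 ^ d := by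
    intro κ
    induction κ with
    | zero => simp
    | succ κ ih =>
      rw [Finset.sum_Icc_succ_top (by omega)]
      have h : 2 * (2 ^ κ) ^ d' ≤ (2 ^ (κ + 1)) ^ d' := by
        rw [pow_succ, mul_pow, mul_comm]
        gcongr
        exact le_self_pow₀ (by norm_num) hd'
      nlinarith [Nat.mul_le_mul_right (2 ^ d) h]
  have hcard' : ((farCells a b l κ).card : ℝ) ≤ 2 * (2 ^ κ) ^ d' * 2 ^ d := by
    exact_mod_cast hcard.trans (hgeom κ)
  have hnear : (n : ℝ) * (1 / 2 ^ κ : ℝ) ^ (d - d') ≤ 2 ^ d * (2 ^ κ) ^ d' := by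
    rw [div_pow, one_pow, mul_one_div, div_le_iff₀ (by positivity), mul_assoc, ← pow_add,
      Nat.add_sub_cancel' hd.le]
    exact h2
  have hn0 : 0 ≤ (n : ℝ) ^ ((d' : ℝ) / d) := by positivity
  calc _ ≤ (2 * (n : ℝ) ^ ((d' : ℝ) / d) * 2 ^ d) * p + 2 ^ d * (n : ℝ) ^ ((d' : ℝ) / d) * p := by
        refine add_le_add ?_ ?_
        · gcongr
          exact hcard'.trans (by gcongr)
        · refine (hnear.trans (by gcongr)).trans (le_mul_of_one_le_right (by positivity) hp)
    _ ≤ _ := by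
        have : 0 ≤ d * (2 ^ d * p * (n : ℝ) ^ ((d' : ℝ) / d)) := by positivity
        nlinarith

/-! ### Conclusion -/

theorem mainTheorem1 {𝕜 : Type*} [RCLike 𝕜] (d d' : ℕ) (hd : d' < d) :
    ∃ C : ℝ, 0 < C ∧
      ∀ (a b : Fin d → ℝ) (l : ℝ), 0 < l → ShareHypersurface a b l d' →
      ∀ k : (Fin d → ℝ) → (Fin d → ℝ) → 𝕜, Measurable (Function.uncurry k) →
        FarFieldAnalytic (hypercube a l) (hypercube b l) k →
      ∀ δ : ℝ, 0 < δ →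
      ∃ p : ℕ, ∀ n : ℕ, 2 ≤ n →
      ∀ (Ω : Type*) [MeasurableSpace Ω] (P : Measure Ω) [IsProbabilityMeasure P]
        (x y : Fin n → Ω → Fin d → ℝ),
        UniformParticles P (hypercube a l) (hypercube b l) x y →
        ∃ K' : Ω → Matrix (Fin n) (Fin n) 𝕜,
          (∀ i j, Measurable fun ω => K' ω i j) ∧
          (∀ᵐ ω ∂P,
            RelErrorLT (kernelMatrix k (fun i => x i ω) (fun j => y j ω)) (K' ω) δ) ∧
          (d' = 0 → ∫⁻ ω, ((K' ω).rank : ENNReal) ∂P ≤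
            ENNReal.ofReal (C * (p * Real.logb (2 ^ d) n))) ∧
          (d' ≠ 0 → ∫⁻ ω, ((K' ω).rank : ENNReal) ∂P ≤
            ENNReal.ofReal (C * (p * (n : ℝ) ^ ((d' : ℝ) / d)))) := by
  classical
  refine ⟨2 ^ d * (3 + d), by positivity, fun a b l hl hab k hk hfar δ hδ => ?_⟩
  obtain ⟨R, hR0, hR⟩ := hfar.exists_mesh (half_pos hδ)
  have : NeZero R := ⟨hR0.ne'⟩
  set N := Fintype.card (Fin d → Fin R) with hN
  have hNR : (N : ℝ) = (R : ℝ) ^ d := by rw [hN]; simp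
  have hN1 : 1 ≤ N := Fintype.card_pos
  -- The expected cost of one far cell; `R`, and so `N`, is fixed by the kernel and `δ` before `n`.
  refine ⟨N + N ^ 2, fun n hn Ω _ P _ x y hxy => ?_⟩
  have : Nonempty (Fin n) := ⟨⟨0, by omega⟩⟩
  set κ := Nat.log (2 ^ d) n with hκ
  set L : Fin n → Ω → (ℕ × (Fin d → ℤ)) × (Fin d → Fin R) :=
    fun j ω => cellLabel a b l R κ (y j ω) with hL
  have hLm : ∀ j, Measurable (L j) := fun j =>
    (measurable_cellLabel a b l R κ).comp (hxy.measurable_source j)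
  have hLind : iIndepFun L P :=
    (hxy.indep.precomp Sum.inr_injective).comp (fun _ => cellLabel a b l R κ)
      fun _ => measurable_cellLabel a b l R κ
  set σ : Ω → Fin n → Fin n := fun ω => cellRepresentative (farCells a b l κ) fun j => L j ω with hσ
  have hσm : ∀ j, Measurable fun ω => σ ω j := fun j =>
    -- The labels form a discrete space, so the choice of representatives needs no measurability
    -- argument of its own.
    (Measurable.of_discrete (f := fun lam : Fin n → (ℕ × (Fin d → ℤ)) × (Fin d → Fin R) =>
      cellRepresentative (farCells a b l κ) lam j)).comp (measurable_pi_lambda _ hLm)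
  have hp1 : (1 : ℝ) ≤ ((N + N ^ 2 : ℕ) : ℝ) := by
    exact_mod_cast (by omega : 1 ≤ N + N ^ 2)
  have hrank : ∫⁻ ω, (((kernelMatrix k (fun i => x i ω) (fun j => y j ω)).submatrix id
      (σ ω)).rank : ENNReal) ∂P ≤ ENNReal.ofReal ((farCells a b l κ).card * ((N + N ^ 2 : ℕ) : ℝ) +
        n * (1 / 2 ^ κ : ℝ) ^ (d - d')) := by
    refine (lintegral_mono fun ω => Nat.cast_le.2 (rank_submatrix_le_card_image _ _)).trans ?_
    refine (lintegral_card_image_cellRepresentative_le P hLind hLm (farCells a b l κ)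
      (v := fun q => (1 / (2 ^ q.1 * R) : ℝ) ^ d) (w := (1 / 2 ^ κ : ℝ) ^ (d - d'))
      (fun q => by positivity) (by positivity)
      (fun q hq r j => le_measureReal_cellLabel_eq hl (hxy.uniform_source j) hq r)
      (fun q _ j => (measureReal_cellLabel_fst_eq_le hl (hxy.uniform_source j) q).trans_eq ?_)
      (fun j => measureReal_cellLabel_notMem_le hl hab (hxy.uniform_source j))).trans_eq ?_
    · have hR0' : (R : ℝ) ≠ 0 := by exact_mod_cast hR0.ne'
      rw [← hN, hNR, ← mul_pow]
      congr 1
      field_simp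
    · rw [← hN, Fintype.card_fin]
      push_cast
      rfl
  refine ⟨fun ω => (kernelMatrix k (fun i => x i ω) (fun j => y j ω)).submatrix id (σ ω),
    fun i j => ?_, ?_, fun h0 => ?_, fun h0 => ?_⟩
  -- The column index is random; treating it as a separate variable in a countable space reduces to
  -- fixed columns.
  · have h : Measurable fun u : Fin n × Ω => k (x i u.2) (y u.1 u.2) :=
      measurable_from_prod_countable_right fun j' =>
        hk.comp ((hxy.measurable_target i).prodMk (hxy.measurable_source j'))
    exact h.comp ((hσm j).prodMk measurable_id)
  · filter_upwards [ae_all_iff.2 fun i => ae_mem_interior_of_isUniform hl (hxy.uniform_target i),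
      ae_all_iff.2 fun j => ae_mem_interior_of_isUniform hl (hxy.uniform_source j)] with ω hx hy
    exact relErrorLT_submatrix_cellRepresentative hl hδ hR κ hx hy
  · subst h0
    exact hrank.trans (ENNReal.ofReal_le_ofReal (card_farCells_add_le_logb hd hn hab hp1))
  · exact hrank.trans (ENNReal.ofReal_le_ofReal (card_farCells_add_le_rpow hd h0 hn hab hp1))
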